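/- For $a\in\mathbb R$ write $\mathbb N_a=\{a,a+1,a+2,\dots\}$ and $[a,c]_{\mathbb N_a}=\{t\in\mathbb N_a: t\le c\}$. Let $t^{(\nu)}=\Gamma(t+1)/\Gamma(t+1-\nu)$, with value $0$ when $t+1-\nu$ is a pole of $\Gamma$ and $t+1$ is not. For $g:\mathbb N_a\to\mathbb R$ and $\nu>0$ let $$\Delta_a^{-\nu}g(t)=\frac1{\Gamma(\nu)}\sum_{s=a}^{t-\nu}(t-s-1)^{(\nu-1)}g(s),$$ let $\Delta_a^{0}g=g$, and let $\Delta_a^{\nu}g=\Delta^N\Delta_a^{-(N-\nu)}g$, where $N\in\mathbb N$, $N-1<\nu\le N$ and $\Delta g(t)=g(t+1)-g(t)$. Let $1<\upsilon<2$, $0<\mu<1$, $b\in\mathbb N=\{0,1,2,\dots\}$, $I=\{0,1,\dots,b+1\}$ and $|\alpha|<1$. For integers $n\ge -1$ put $$e(n)=e_{\upsilon-\mu,\upsilon}(\alpha,n)=\sum_{k=0}^{\infty}\alpha^k\,\frac{(n+k(\upsilon-\mu)+\upsilon-1)^{(k(\upsilon-\mu)+\upsilon-1)}}{\Gamma(k(\upsilon-\mu)+\upsilon)},$$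 and assume that $e(b+2)\neq0$. For $t\in[\upsilon-2,\upsilon+b+1]_{\mathbb N_{\upsilon-2}}$ and $s\in[\upsilon-1,\upsilon+b]_{\mathbb N_{\upsilon-1}}$ let $$G(t,s)=\begin{cases}\dfrac{e(t-\upsilon+1)}{e(b+2)}\,e(\upsilon+b-s)-e(t-s-1), & s\le t,\\[2mm] \dfrac{e(t-\upsilon+1)}{e(b+2)}\,e(\upsilon+b-s), & t+1\le s.\end{cases}$$ Let $f:[\upsilon-1,\upsilon+b]_{\mathbb N_{\upsilon-1}}\times\mathbb R\to\mathbb R$ be continuous, and suppose that there is $m\in\mathbb R$ with $$\lim_{|r|\to\infty}\frac{f(t+\upsilon-1,r)}{r}=m\qquad\text{for all }t\in I .$$ If $$|m|<d:=\frac{1}{\displaystyle\max_{t\in[\upsilon-2,\upsilon+b+1]_{\mathbb N_{\upsilon-2}}}\ \sum_{s=\upsilon-1}^{\upsilon+b}|G(t,s)|},$$ then the boundary value problem $$-\Delta^{\upsilon}y(t)+\alpha\,\Delta^{\mu}y(t+\upsilon-\mu)=f(t+\upsilon-1,\,y(t+\upsilon-1)),\quad t\in I,\qquad y(\upsilon-2)=y(\upsilon+b+1)=0,$$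 has a solution $y:[\upsilon-2,\upsilon+b+1]_{\mathbb N_{\upsilon-2}}\to\mathbb R$. Here $\Delta^{\upsilon}y=\Delta^{\upsilon}_{\upsilon-2}y$, and $\Delta^{\mu}y(t+\upsilon-\mu)$ denotes $\Delta^{\mu}_{\mu-1}Y_1(t)$ with $Y_1(\tau)=y(\tau+\upsilon-\mu)$. Moreover, $y\not\equiv0$ on $[\upsilon-2,\upsilon+b+1]_{\mathbb N_{\upsilon-2}}$ when $f(t+\upsilon-1,0)\neq0$ for at least one $t\in I$. -/

import Mathlib

open Filter Topology

noncomputable section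

/-- The finite grid `[a, c]_{ℕ_a} = {a, a + 1, a + 2, …} ∩ (-∞, c]`; it is empty if `c < a`. -/
def grid (a c : ℝ) : Finset ℝ :=
  (Finset.range ⌊c - a + 1⌋₊).image fun k : ℕ => a + (k : ℝ)

theorem mem_grid {a c t : ℝ} : t ∈ grid a c ↔ ∃ k : ℕ, t = a + (k : ℝ) ∧ t ≤ c := by
  unfold grid
  simp only [Finset.mem_image, Finset.mem_range]
  constructor
  · rintro ⟨k, hk, rfl⟩
    refine ⟨k, rfl, ?_⟩
    have h := Nat.add_one_le_iff.mpr hk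
    rw [Nat.le_floor_iff' (by omega)] at h
    push_cast at h
    linarith
  · rintro ⟨k, rfl, hk⟩
    refine ⟨k, ?_, rfl⟩
    rw [← Nat.add_one_le_iff, Nat.le_floor_iff' (by omega)]
    push_cast
    linarith

theorem grid_nonempty {a c : ℝ} (h : a ≤ c) : (grid a c).Nonempty :=
  ⟨a, mem_grid.mpr ⟨0, by simp, h⟩⟩

/-- The falling power `t^(ν) = Γ(t + 1) / Γ(t + 1 - ν)`. The value is `0` when `t + 1 - ν` is a pole
of the Gamma function, because Mathlib's `Real.Gamma` takes the value `0` at its poles. -/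
def fallPow (t ν : ℝ) : ℝ := Real.Gamma (t + 1) / Real.Gamma (t + 1 - ν)

/-- The fractional sum `Δ^{-ν} f(t; a)` of order `ν ≥ 0` of a function `f` on `ℕ_a`, at points
`t ∈ ℕ_{a + ν}`. The sum of order `0` is `f` itself. Only the values of `f` on `ℕ_a` enter. -/
def fracSum (a ν : ℝ) (f : ℝ → ℝ) (t : ℝ) : ℝ :=
  if ν = 0 then f t
  else 1 / Real.Gamma ν * ∑ s ∈ grid a (t - ν), fallPow (t - s - 1) (ν - 1) * f s

/-- The Riemann–Liouville fractional difference `Δ^ν f = Δ^N Δ^{-(N - ν)} f` with base point `a`,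
where `N - 1 < ν ≤ N` and `Δ g(t) = g(t + 1) - g(t)`. -/
def fracDiff (a ν : ℝ) (f : ℝ → ℝ) : ℝ → ℝ :=
  (fwdDiff (1 : ℝ))^[⌈ν⌉₊] (fracSum a ((⌈ν⌉₊ : ℝ) - ν) f)

/-- The two parameter delta discrete Mittag-Leffler function `e_{θ, β}(l, x)`. -/
def mittagLeffler (θ β l x : ℝ) : ℝ :=
  ∑' k : ℕ, l ^ k *
    (fallPow (x + (k : ℝ) * θ + β - 1) ((k : ℝ) * θ + β - 1) / Real.Gamma ((k : ℝ) * θ + β))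

/-- The function `G(t, s)`. -/
def green (υ μ α : ℝ) (b : ℕ) (t s : ℝ) : ℝ :=
  if s ≤ t then
    mittagLeffler (υ - μ) υ α (t - υ + 1) / mittagLeffler (υ - μ) υ α ((b : ℝ) + 2) *
        mittagLeffler (υ - μ) υ α (υ + (b : ℝ) - s) -
      mittagLeffler (υ - μ) υ α (t - s - 1)
  else
    mittagLeffler (υ - μ) υ α (t - υ + 1) / mittagLeffler (υ - μ) υ α ((b : ℝ) + 2) *
      mittagLeffler (υ - μ) υ α (υ + (b : ℝ) - s)

theorem grid_dirichlet_nonempty (υ : ℝ) (b : ℕ) :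
    (grid (υ - 2) (υ + (b : ℝ) + 1)).Nonempty :=
  grid_nonempty (by have : (0 : ℝ) ≤ (b : ℝ) := Nat.cast_nonneg b; linarith)

/-- The maximum over `t ∈ [υ - 2, υ + b + 1]` of the sums `∑_{s = υ - 1}^{υ + b} |G(t, s)|`. -/
def greenMax (υ μ α : ℝ) (b : ℕ) : ℝ :=
  (grid (υ - 2) (υ + (b : ℝ) + 1)).sup' (grid_dirichlet_nonempty υ b)
    fun t => ∑ s ∈ grid (υ - 1) (υ + (b : ℝ)), |green υ μ α b t s|

/-- `y` solves `-Δ^υ y(t) + α Δ^μ y(t + υ - μ) = f(t + υ - 1, y(t + υ - 1))` for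
`t ∈ {0, 1, …, b + 1}`, with `y(υ - 2) = y(υ + b + 1) = 0`. The second term is the fractional
difference, with base point `μ - 1`, of the shifted function `τ ↦ y(τ + υ - μ)` on `ℕ_{μ - 1}`.
Only the values of `y` on the grid `[υ - 2, υ + b + 1]` enter. -/
def IsDirichletSolution (υ μ α : ℝ) (b : ℕ) (f : ℝ → ℝ → ℝ) (y : ℝ → ℝ) : Prop :=
  (∀ t ∈ grid 0 ((b : ℝ) + 1),
    -fracDiff (υ - 2) υ y t + α * fracDiff (μ - 1) μ (fun τ => y (τ + υ - μ)) t =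
      f (t + υ - 1) (y (t + υ - 1))) ∧
  y (υ - 2) = 0 ∧ y (υ + (b : ℝ) + 1) = 0

end

/-! Generating functions turn fractional sums and differences into multiplication by powers of `1 -
X`. Since `y (υ - 2) = 0`, the operator becomes multiplication by `-P`, where `P = (1 - X)^υ - α (1
- X)^μ`, and the Mittag-Leffler values `e n` are the coefficients of `1 / P`
(`sub_mul_mk_mittagLeffler`). The equation is thus a discrete Volterra recursion with one free
parameter `c`, and it remains to choose `c` so that the right end value vanishes.

This is shooting. As `|c| → ∞`, the solution divided by `c` tends to the solution `w` of the linear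
recursion with slope `m` (`tendsto_volterra_div`). If `w` vanished at the right end, it would
satisfy `w = m * ∑ G w`, which `|m| < d` and `w 0 = e 0 ≠ 0` forbid (`volterra_linear_ne_zero`). So
the end value has opposite signs for large `c` and `-c`, and the intermediate value theorem applies.
-/

noncomputable section

/-! ### Binomial series -/

/-- The power series `(1 - X) ^ (-ν)`. -/
def negBinomialSeries (ν : ℝ) : PowerSeries ℝ :=
  PowerSeries.mk fun n => Ring.multichoose ν n

theorem coeff_negBinomialSeries (ν : ℝ) (n : ℕ) :
    PowerSeries.coeff n (negBinomialSeries ν) = Ring.multichoose ν n :=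
  PowerSeries.coeff_mk _ _

theorem negBinomialSeries_eq_rescale (ν : ℝ) :
    negBinomialSeries ν =
      PowerSeries.rescale (-1 : ℝ) (PowerSeries.binomialSeries ℝ (-ν)) := by
  ext n
  rw [coeff_negBinomialSeries, PowerSeries.coeff_rescale, PowerSeries.binomialSeries_coeff,
    Ring.choose_neg, Ring.multichoose_eq]
  rcases Nat.even_or_odd n with h | h
  · simp [h.neg_one_pow, Int.negOnePow_even n (by exact_mod_cast h)]
  · simp [h.neg_one_pow, Int.negOnePow_odd n (by exact_mod_cast h)]

theorem negBinomialSeries_add (ν ν' : ℝ) :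
    negBinomialSeries (ν + ν') = negBinomialSeries ν * negBinomialSeries ν' := by
  simp only [negBinomialSeries_eq_rescale, neg_add, PowerSeries.binomialSeries_add, map_mul]

theorem negBinomialSeries_zero : negBinomialSeries 0 = 1 := by
  simp [negBinomialSeries_eq_rescale]

theorem negBinomialSeries_neg_one : negBinomialSeries (-1) = 1 - PowerSeries.X := by
  have h := PowerSeries.binomialSeries_nat (R := ℝ) (A := ℝ) 1
  rw [negBinomialSeries_eq_rescale, neg_neg, ← Nat.cast_one, h]
  simp [sub_eq_add_neg]

theorem multichoose_eq_eval_ascPochhammer (ν : ℝ) (n : ℕ) :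
    Ring.multichoose ν n = (ascPochhammer ℝ n).eval ν / n.factorial := by
  have h := Ring.factorial_nsmul_multichoose_eq_ascPochhammer ν n
  rw [Polynomial.ascPochhammer_smeval_eq_eval, nsmul_eq_mul] at h
  rw [← h]
  field_simp

theorem Gamma_add_natCast_eq {ν : ℝ} (hν : 0 < ν) (n : ℕ) :
    Real.Gamma (ν + n) = (ascPochhammer ℝ n).eval ν * Real.Gamma ν := by
  induction n with
  | zero => simp
  | succ n ih =>
    rw [Nat.cast_succ, ← add_assoc, Real.Gamma_add_one (by positivity), ih,
      ascPochhammer_succ_eval]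
    ring

theorem multichoose_eq_Gamma {ν : ℝ} (hν : 0 < ν) (n : ℕ) :
    Ring.multichoose ν n = Real.Gamma (ν + n) / Real.Gamma (n + 1) / Real.Gamma ν := by
  have := (Real.Gamma_pos_of_pos hν).ne'
  rw [multichoose_eq_eval_ascPochhammer, Gamma_add_natCast_eq hν, Real.Gamma_nat_eq_factorial]
  field_simp

/-! ### Fractional sums and differences as power series products -/

theorem grid_add_natCast (a : ℝ) (n : ℕ) :
    grid a (a + n) = (Finset.range (n + 1)).image fun k : ℕ => a + (k : ℝ) := by
  unfold grid
  rw [show a + (n : ℝ) - a + 1 = ((n + 1 : ℕ) : ℝ) by push_cast; ring, Nat.floor_natCast]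

theorem sum_grid {a c : ℝ} {n : ℕ} (h : c = a + n) (g : ℝ → ℝ) :
    ∑ s ∈ grid a c, g s = ∑ k ∈ Finset.range (n + 1), g (a + k) := by
  rw [h, grid_add_natCast, Finset.sum_image]
  intro x _ y _ hxy
  simpa using hxy

theorem mem_grid_iff_of_eq {a c : ℝ} {n : ℕ} (h : c = a + n) {t : ℝ} :
    t ∈ grid a c ↔ ∃ k ≤ n, t = a + (k : ℝ) := by
  rw [h, grid_add_natCast]
  simp only [Finset.mem_image, Finset.mem_range, Nat.lt_succ_iff]
  constructor
  · rintro ⟨k, hk, rfl⟩; exact ⟨k, hk, rfl⟩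
  · rintro ⟨k, hk, rfl⟩; exact ⟨k, hk, rfl⟩

/-- Fractional summation of order `ν` is multiplication by `(1 - X) ^ (-ν)`. -/
theorem fracSum_eq_coeff {ν : ℝ} (hν : 0 < ν) (a : ℝ) (f : ℝ → ℝ) {t : ℝ} {k : ℕ}
    (ht : t = a + ν + k) :
    fracSum a ν f t = PowerSeries.coeff k
      (negBinomialSeries ν * PowerSeries.mk fun j : ℕ => f (a + j)) := by
  rw [fracSum, if_neg hν.ne', sum_grid (n := k) (by rw [ht]; ring), mul_comm (negBinomialSeries ν),
    PowerSeries.coeff_mul, Finset.Nat.sum_antidiagonal_eq_sum_range_succ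
      (fun i j => PowerSeries.coeff i (PowerSeries.mk fun j : ℕ => f (a + j)) *
        PowerSeries.coeff j (negBinomialSeries ν)), Finset.mul_sum]
  refine Finset.sum_congr rfl fun j hj => ?_
  have hjk : j ≤ k := Nat.lt_succ_iff.mp (Finset.mem_range.mp hj)
  rw [PowerSeries.coeff_mk, coeff_negBinomialSeries, multichoose_eq_Gamma hν, Nat.cast_sub hjk,
    fallPow, ht]
  rw [show a + ν + k - (a + j) - 1 + 1 = ν + (k - j : ℝ) by ring,
    show ν + (k - j : ℝ) - (ν - 1) = k - j + 1 by ring]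
  ring

theorem coeff_succ_one_sub_X_mul (φ : PowerSeries ℝ) (n : ℕ) :
    PowerSeries.coeff (n + 1) ((1 - PowerSeries.X) * φ) =
      PowerSeries.coeff (n + 1) φ - PowerSeries.coeff n φ := by
  rw [sub_mul, one_mul, map_sub, PowerSeries.coeff_succ_X_mul]

/-- The forward difference supplies a factor `1 - X`, which combines with `(1 - X) ^ (-(1 - μ))`. It
involves coefficients `k` and `k + 1`, whence the index. -/
theorem fracDiff_eq_coeff_of_lt_one {μ : ℝ} (hμ : 0 < μ) (hμ' : μ < 1) (g : ℝ → ℝ) (k : ℕ) :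
    fracDiff (μ - 1) μ g k = PowerSeries.coeff (k + 1)
      (negBinomialSeries (-μ) * PowerSeries.mk fun j : ℕ => g (μ - 1 + j)) := by
  have hc : ⌈μ⌉₊ = 1 := by
    rw [Nat.ceil_eq_iff one_ne_zero]; constructor <;> norm_num <;> linarith
  rw [fracDiff, hc, Function.iterate_one, fwdDiff, Nat.cast_one,
    fracSum_eq_coeff (k := k + 1) (by linarith) _ _ (by push_cast; ring),
    fracSum_eq_coeff (k := k) (by linarith) _ _ (by ring),
    show -μ = -1 + (1 - μ) by ring, negBinomialSeries_add, negBinomialSeries_neg_one, mul_assoc,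
    coeff_succ_one_sub_X_mul]

theorem fracDiff_eq_coeff_of_lt_two {υ : ℝ} (hυ : 1 < υ) (hυ' : υ < 2) (g : ℝ → ℝ) (k : ℕ) :
    fracDiff (υ - 2) υ g k = PowerSeries.coeff (k + 2)
      (negBinomialSeries (-υ) * PowerSeries.mk fun j : ℕ => g (υ - 2 + j)) := by
  have hc : ⌈υ⌉₊ = 2 := by
    rw [Nat.ceil_eq_iff two_ne_zero]; constructor <;> norm_num <;> linarith
  rw [fracDiff, hc, Function.iterate_succ, Function.iterate_one, Function.comp_apply]
  simp only [fwdDiff]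
  rw [Nat.cast_ofNat,
    fracSum_eq_coeff (k := k + 1 + 1) (by linarith) _ _ (by push_cast; ring),
    fracSum_eq_coeff (k := k + 1) (by linarith) _ _ (by push_cast; ring),
    fracSum_eq_coeff (k := k) (by linarith) _ _ (by ring),
    show -υ = -1 + (-1 + (2 - υ)) by ring, negBinomialSeries_add, negBinomialSeries_add,
    negBinomialSeries_neg_one, mul_assoc, mul_assoc, coeff_succ_one_sub_X_mul,
    coeff_succ_one_sub_X_mul, coeff_succ_one_sub_X_mul]

/-! ### The Mittag-Leffler function -/

theorem mittagLeffler_term {p : ℝ} (hp : 0 < p) (n : ℕ) :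
    fallPow (n + p - 1) (p - 1) / Real.Gamma p = Ring.multichoose p n := by
  rw [multichoose_eq_Gamma hp, fallPow, show (n : ℝ) + p - 1 + 1 = p + n by ring,
    show p + n - (p - 1) = (n : ℝ) + 1 by ring]

theorem mittagLeffler_natCast {θ β : ℝ} (hθ : 0 ≤ θ) (hβ : 0 < β) (l : ℝ) (n : ℕ) :
    mittagLeffler θ β l n = ∑' k : ℕ, l ^ k * Ring.multichoose (k * θ + β) n := by
  unfold mittagLeffler
  refine tsum_congr fun k => ?_
  rw [← mittagLeffler_term (p := k * θ + β) (by positivity)]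
  ring_nf

theorem mittagLeffler_neg_one (θ β l : ℝ) : mittagLeffler θ β l (-1) = 0 := by
  unfold mittagLeffler
  have (k : ℕ) : fallPow (-1 + (k : ℝ) * θ + β - 1) ((k : ℝ) * θ + β - 1) = 0 := by
    rw [fallPow, show -1 + (k : ℝ) * θ + β - 1 + 1 - ((k : ℝ) * θ + β - 1) = 0 by ring,
      Real.Gamma_zero, div_zero]
  simp [this]

theorem summable_pow_mul_eval {l : ℝ} (hl : |l| < 1) (p : Polynomial ℝ) :
    Summable fun k : ℕ => l ^ k * p.eval (k : ℝ) := by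
  induction p using Polynomial.induction_on' with
  | add p q hp hq => simpa [mul_add] using hp.add hq
  | monomial n a =>
    simpa [mul_comm, mul_left_comm] using
      (summable_pow_mul_geometric_of_norm_lt_one n (r := l) hl).mul_left a

/-- For fixed `n` the binomial coefficient is a polynomial in `k`, dominated by geometric decay. -/
theorem summable_pow_mul_multichoose {l : ℝ} (hl : |l| < 1) (θ β : ℝ) (n : ℕ) :
    Summable fun k : ℕ => l ^ k * Ring.multichoose (k * θ + β) n := by
  have h := (summable_pow_mul_eval hl ((ascPochhammer ℝ n).comp
    (Polynomial.C θ * Polynomial.X + Polynomial.C β))).div_const (n.factorial : ℝ)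
  refine h.congr fun k => ?_
  rw [multichoose_eq_eval_ascPochhammer]
  simp [mul_div_assoc, mul_comm θ]

/-- The generating function of the Mittag-Leffler function is
`1 / ((1 - X) ^ υ - α (1 - X) ^ μ)`. -/
theorem sub_mul_mk_mittagLeffler {υ μ α : ℝ} (hυ : 0 < υ) (hμ : μ ≤ υ) (hα : |α| < 1) :
    (negBinomialSeries (-υ) - PowerSeries.C α * negBinomialSeries (-μ)) *
      (PowerSeries.mk fun n : ℕ => mittagLeffler (υ - μ) υ α n) = 1 := by
  ext n
  have hs := fun j => summable_pow_mul_multichoose hα (υ - μ) υ j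
  set P := negBinomialSeries (-υ) - PowerSeries.C α * negBinomialSeries (-μ) with hP
  -- Consecutive terms share a power of `1 - X`, so the series over `k` telescopes.
  have key (k : ℕ) : P * negBinomialSeries (k * (υ - μ) + υ) =
      negBinomialSeries (k * (υ - μ)) -
        PowerSeries.C α * negBinomialSeries ((k + 1 : ℕ) * (υ - μ)) := by
    rw [hP, sub_mul, mul_assoc, ← negBinomialSeries_add, ← negBinomialSeries_add]
    congr 3 <;> push_cast <;> ring_nf
  have h0 : Summable fun k : ℕ => α ^ k * Ring.multichoose (k * (υ - μ)) n := by
    simpa using summable_pow_mul_multichoose hα (υ - μ) 0 n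
  calc PowerSeries.coeff n (P * PowerSeries.mk fun n : ℕ => mittagLeffler (υ - μ) υ α n)
      = ∑ x ∈ Finset.HasAntidiagonal.antidiagonal n, ∑' k : ℕ, α ^ k *
          (PowerSeries.coeff x.1 P * Ring.multichoose (k * (υ - μ) + υ) x.2) := by
        rw [PowerSeries.coeff_mul]
        refine Finset.sum_congr rfl fun x _ => ?_
        rw [PowerSeries.coeff_mk, mittagLeffler_natCast (by linarith) hυ, ← tsum_mul_left]
        exact tsum_congr fun k => by ring
    _ = ∑' k : ℕ, α ^ k * PowerSeries.coeff n (P * negBinomialSeries (k * (υ - μ) + υ)) := by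
        rw [← Summable.tsum_finsetSum]
        · refine tsum_congr fun k => ?_
          rw [PowerSeries.coeff_mul, Finset.mul_sum]
          simp only [coeff_negBinomialSeries]
        · intro x _
          exact ((hs x.2).mul_left (PowerSeries.coeff x.1 P)).congr fun k => by ring
    _ = ∑' k : ℕ, (α ^ k * Ring.multichoose (k * (υ - μ)) n -
          α ^ (k + 1) * Ring.multichoose ((k + 1 : ℕ) * (υ - μ)) n) := by
        refine tsum_congr fun k => ?_
        rw [key, map_sub, PowerSeries.coeff_C_mul, coeff_negBinomialSeries,
          coeff_negBinomialSeries]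
        ring
    _ = PowerSeries.coeff n (1 : PowerSeries ℝ) := by
        rw [h0.tsum_sub ((summable_nat_add_iff 1).2 h0), h0.tsum_eq_zero_add]
        simp only [add_sub_cancel_right, ← negBinomialSeries_zero, coeff_negBinomialSeries]
        simp

/-! ### Shooting for a discrete Volterra equation -/

/-- The solution of `v j = c * e j - ∑ i < j, e (j - 1 - i) * F i (v i)`. -/
def volterra (e : ℕ → ℝ) (F : ℕ → ℝ → ℝ) (c : ℝ) : ℕ → ℝ
  | j => c * e j - ∑ i : Fin j, e (j - 1 - i) * F i (volterra e F c i)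
decreasing_by exact i.2

theorem volterra_eq (e : ℕ → ℝ) (F : ℕ → ℝ → ℝ) (c : ℝ) (j : ℕ) :
    volterra e F c j =
      c * e j - ∑ i ∈ Finset.range j, e (j - 1 - i) * F i (volterra e F c i) := by
  rw [volterra, Finset.sum_range]

theorem continuous_volterra {e : ℕ → ℝ} {F : ℕ → ℝ → ℝ} {N : ℕ}
    (hF : ∀ i < N, Continuous (F i)) :
    ∀ j ≤ N, Continuous fun c => volterra e F c j := by
  intro j
  induction j using Nat.strong_induction_on with
  | _ j ih =>
    intro hj
    simp_rw [volterra_eq e F _ j]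
    refine (continuous_id.mul continuous_const).sub (continuous_finsetSum _ fun i hi => ?_)
    have hij := Finset.mem_range.mp hi
    exact continuous_const.mul ((hF i (hij.trans_le hj)).comp (ih i hij (hij.le.trans hj)))

/-! ### Asymptotics of the shooting map -/

theorem eventually_comap_abs_atTop {p : ℝ → Prop} :
    (∀ᶠ c in comap (fun r : ℝ => |r|) atTop, p c) ↔ ∃ R, ∀ c, R ≤ |c| → p c := by
  simpa using ((atTop_basis (α := ℝ)).comap fun r : ℝ => |r|).eventually_iff (q := p)

theorem exists_abs_sub_mul_le {φ : ℝ → ℝ} {m : ℝ} (hφ : Continuous φ)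
    (hlim : Tendsto (fun r => φ r / r) (comap (fun r : ℝ => |r|) atTop) (𝓝 m)) {ε : ℝ}
    (hε : 0 < ε) : ∃ C, ∀ r, |φ r - m * r| ≤ ε * |r| + C := by
  obtain ⟨R, hR⟩ := eventually_comap_abs_atTop.1 (Metric.tendsto_nhds.1 hlim ε hε)
  have hg : Continuous fun r => φ r - m * r := by fun_prop
  obtain ⟨C, hC⟩ := (isCompact_Icc (a := -|R|) (b := |R|)).exists_bound_of_continuousOn
    hg.continuousOn
  refine ⟨max C 0, fun r => ?_⟩
  rcases le_or_gt |r| |R| with h | h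
  · have h1 := hC r (abs_le.1 h)
    have h2 := le_max_left C 0
    have h3 : 0 ≤ ε * |r| := by positivity
    rw [Real.norm_eq_abs] at h1
    linarith
  · have hr : r ≠ 0 := abs_pos.1 ((abs_nonneg R).trans_lt h)
    have h1 := hR r ((le_abs_self R).trans h.le)
    rw [Real.dist_eq] at h1
    have h2 : φ r - m * r = (φ r / r - m) * r := by field_simp
    rw [h2, abs_mul]
    have := mul_le_mul_of_nonneg_right h1.le (abs_nonneg r)
    linarith [le_max_right C 0]

/-- The limit `w` may be `0`, so `u c` need not be unbounded; the global bound `ε * |r| + C` on the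
deviation covers this case too. -/
theorem tendsto_comp_div {φ u : ℝ → ℝ} {m w : ℝ} (hφ : Continuous φ)
    (hlim : Tendsto (fun r => φ r / r) (comap (fun r : ℝ => |r|) atTop) (𝓝 m))
    (hu : Tendsto (fun c => u c / c) (comap (fun r : ℝ => |r|) atTop) (𝓝 w)) :
    Tendsto (fun c => φ (u c) / c) (comap (fun r : ℝ => |r|) atTop) (𝓝 (m * w)) := by
  have habs : Tendsto (fun r : ℝ => |r|) (comap (fun r : ℝ => |r|) atTop) atTop := tendsto_comap
  suffices h : Tendsto (fun c => (φ (u c) - m * u c) / c)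
      (comap (fun r : ℝ => |r|) atTop) (𝓝 0) by
    have := h.add (hu.const_mul m)
    rw [zero_add] at this
    exact this.congr fun c => by ring
  rw [Metric.tendsto_nhds]
  intro δ hδ
  -- Budget: `|w| + 1` shares of `δ / (|w| + 2)` for the linear part and one for the constant.
  have hw : 0 < |w| + 2 := by positivity
  obtain ⟨C, hC⟩ := exists_abs_sub_mul_le hφ hlim (div_pos hδ hw)
  have h1 : ∀ᶠ c in comap (fun r : ℝ => |r|) atTop, |u c / c| < |w| + 1 :=
    hu.abs.eventually (gt_mem_nhds (lt_add_one |w|))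
  have h2 : ∀ᶠ c in comap (fun r : ℝ => |r|) atTop, C / |c| < δ / (|w| + 2) :=
    (habs.const_div_atTop C).eventually (gt_mem_nhds (div_pos hδ hw))
  filter_upwards [h1, h2] with c hc1 hc2
  rw [Real.dist_eq, sub_zero, abs_div]
  calc |φ (u c) - m * u c| / |c| ≤ (δ / (|w| + 2) * |u c| + C) / |c| := by gcongr; exact hC _
    _ = δ / (|w| + 2) * |u c / c| + C / |c| := by rw [abs_div]; ring
    _ < δ / (|w| + 2) * (|w| + 1) + δ / (|w| + 2) := by gcongr
    _ = δ := by field_simp; ring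

/-- Dividing the recursion by `c` and passing to the limit gives the linear recursion with slope
`m`. -/
theorem tendsto_volterra_div {e : ℕ → ℝ} {F : ℕ → ℝ → ℝ} {m : ℝ} {N : ℕ}
    (hF : ∀ i < N, Continuous (F i))
    (hlim : ∀ i < N,
      Tendsto (fun r => F i r / r) (comap (fun r : ℝ => |r|) atTop) (𝓝 m)) :
    ∀ j ≤ N, Tendsto (fun c => volterra e F c j / c) (comap (fun r : ℝ => |r|) atTop)
      (𝓝 (volterra e (fun _ r => m * r) 1 j)) := by
  intro j
  induction j using Nat.strong_induction_on with
  | _ j ih =>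
    intro hj
    rw [volterra_eq e (fun _ r => m * r)]
    have h1 : Tendsto (fun c : ℝ => e j -
        ∑ i ∈ Finset.range j, e (j - 1 - i) * (F i (volterra e F c i) / c))
        (comap (fun r : ℝ => |r|) atTop) (𝓝 (1 * e j - ∑ i ∈ Finset.range j,
          e (j - 1 - i) * (m * volterra e (fun _ r => m * r) 1 i))) := by
      rw [one_mul]
      refine tendsto_const_nhds.sub (tendsto_finsetSum _ fun i hi => ?_)
      have hij := Finset.mem_range.mp hi
      exact (tendsto_comp_div (hF i (hij.trans_le hj)) (hlim i (hij.trans_le hj))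
        (ih i hij (hij.le.trans hj))).const_mul _
    refine h1.congr' (eventually_comap_abs_atTop.2 ⟨1, fun c hc => ?_⟩)
    have hc0 : c ≠ 0 := by rintro rfl; norm_num at hc
    change _ = volterra e F c j / c
    rw [volterra_eq e F c j, sub_div, Finset.sum_div, mul_div_right_comm, div_self hc0, one_mul]
    simp only [mul_div_assoc]

/-- If the Green function of the linear problem has small sums, then the linear solution with
slope `m` does not vanish at the right end point. -/
theorem volterra_linear_ne_zero {e : ℕ → ℝ} {m K : ℝ} {N : ℕ} (he0 : e 0 ≠ 0) (heN : e N ≠ 0)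
    (hK : ∀ j ≤ N, ∑ i ∈ Finset.range N,
      |e j / e N * e (N - 1 - i) - if i < j then e (j - 1 - i) else 0| ≤ K)
    (hm : |m| * K < 1) : volterra e (fun _ r => m * r) 1 N ≠ 0 := by
  intro hN
  set w := volterra e (fun _ r => m * r) 1 with hw
  have hw0 : w 0 = e 0 := by rw [hw, volterra_eq]; simp
  have h1 : e N = ∑ i ∈ Finset.range N, e (N - 1 - i) * (m * w i) := by
    have := volterra_eq e (fun _ r => m * r) 1 N
    rw [← hw, hN] at this
    linarith
  have hrep : ∀ j ≤ N, w j = m * ∑ i ∈ Finset.range N,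
      (e j / e N * e (N - 1 - i) - if i < j then e (j - 1 - i) else 0) * w i := by
    intro j hj
    have h2 : ∑ i ∈ Finset.range j, e (j - 1 - i) * (m * w i) =
        ∑ i ∈ Finset.range N, (if i < j then e (j - 1 - i) else 0) * (m * w i) := by
      rw [← Finset.sum_subset (Finset.range_mono hj)]
      · exact Finset.sum_congr rfl fun i hi => by rw [if_pos (Finset.mem_range.mp hi)]
      · intro i _ hi
        rw [if_neg (by simpa using hi), zero_mul]
    -- Inserting the end condition `h1` into the homogeneous term produces the first summand of the
    -- Green function.
    have h3 : e j = ∑ i ∈ Finset.range N, e j / e N * e (N - 1 - i) * (m * w i) := by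
      calc e j = e j / e N * e N := by field_simp
        _ = _ := by
          -- This also rewrites the denominator, which `← h1` restores.
          conv_lhs => rw [h1]
          rw [Finset.mul_sum, ← h1]
          exact Finset.sum_congr rfl fun i _ => by ring
    have h4 := volterra_eq e (fun _ r => m * r) 1 j
    rw [← hw, h2] at h4
    rw [h4, one_mul]
    conv_lhs => rw [h3]
    rw [← Finset.sum_sub_distrib, Finset.mul_sum]
    exact Finset.sum_congr rfl fun i _ => by ring
  obtain ⟨j, hj, hmax⟩ := Finset.exists_max_image (Finset.range (N + 1)) (fun j => |w j|)
    ⟨0, by simp⟩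
  have hjN : j ≤ N := Nat.lt_succ_iff.mp (Finset.mem_range.mp hj)
  have hpos : 0 < |w j| := (abs_pos.2 he0).trans_le (by rw [← hw0]; exact hmax 0 (by simp))
  have hle : |w j| ≤ |m| * K * |w j| := by
    conv_lhs => rw [hrep j hjN, abs_mul]
    rw [mul_assoc]
    refine mul_le_mul_of_nonneg_left ?_ (abs_nonneg m)
    refine (Finset.abs_sum_le_sum_abs _ _).trans ?_
    refine le_trans ?_ (mul_le_mul_of_nonneg_right (hK j hjN) (abs_nonneg (w j)))
    rw [Finset.sum_mul]
    refine Finset.sum_le_sum fun i hi => ?_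
    rw [abs_mul]
    refine mul_le_mul_of_nonneg_left (hmax i ?_) (abs_nonneg _)
    have := Finset.mem_range.mp hi
    exact Finset.mem_range.mpr (by omega)
  nlinarith

theorem exists_volterra_eq_zero {e : ℕ → ℝ} {F : ℕ → ℝ → ℝ} {m K : ℝ} {N : ℕ}
    (hF : ∀ i < N, Continuous (F i))
    (hlim : ∀ i < N,
      Tendsto (fun r => F i r / r) (comap (fun r : ℝ => |r|) atTop) (𝓝 m))
    (he0 : e 0 ≠ 0) (heN : e N ≠ 0)
    (hK : ∀ j ≤ N, ∑ i ∈ Finset.range N,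
      |e j / e N * e (N - 1 - i) - if i < j then e (j - 1 - i) else 0| ≤ K)
    (hm : |m| * K < 1) : ∃ c, volterra e F c N = 0 := by
  have hW := volterra_linear_ne_zero he0 heN hK hm
  set W := volterra e (fun _ r => m * r) 1 N
  have hWlim := tendsto_volterra_div (e := e) hF hlim N le_rfl
  have hcont := continuous_volterra (e := e) hF N le_rfl
  -- Multiplying by `W` makes the limit positive whatever the sign of `W`.
  have hprod : Tendsto (fun c => volterra e F c N / c * W) (comap (fun r : ℝ => |r|) atTop)
      (𝓝 (W * W)) := hWlim.mul_const W
  obtain ⟨R, hR⟩ := eventually_comap_abs_atTop.1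
    (hprod.eventually (lt_mem_nhds (mul_self_pos.2 hW)))
  obtain ⟨r, hr, hr0⟩ : ∃ r : ℝ, R ≤ r ∧ 0 < r := ⟨max R 1, le_max_left _ _, by positivity⟩
  have h1 : 0 < volterra e F r N * W := by
    have h := mul_pos (hR r (by rwa [abs_of_pos hr0])) hr0
    field_simp at h
    linarith
  have h2 : volterra e F (-r) N * W < 0 := by
    have h := mul_pos (hR (-r) (by rwa [abs_neg, abs_of_pos hr0])) hr0
    field_simp at h
    linarith
  have hc : Continuous fun c => volterra e F c N * W := hcont.mul continuous_const
  obtain ⟨c, -, hc0⟩ := intermediate_value_uIcc (a := -r) (b := r) hc.continuousOn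
    (show (0 : ℝ) ∈ _ from Set.mem_uIcc.2 (Or.inl ⟨h2.le, h1.le⟩))
  exact ⟨c, (mul_eq_zero.1 hc0).resolve_right hW⟩

/-! ### The boundary value problem -/

/-- On the diagonal the subtracted term is `e (-1) = 0`, so the condition `s ≤ t` may be replaced by
`i < j`. -/
theorem green_grid (υ μ α : ℝ) (b j i : ℕ) (hi : i ≤ b + 1) :
    green υ μ α b (υ - 1 + j) (υ - 1 + i) =
      mittagLeffler (υ - μ) υ α j / mittagLeffler (υ - μ) υ α (b + 2 : ℕ) *
          mittagLeffler (υ - μ) υ α (b + 2 - 1 - i : ℕ) -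
        if i < j then mittagLeffler (υ - μ) υ α (j - 1 - i : ℕ) else 0 := by
  have h1 : υ - 1 + (j : ℝ) - υ + 1 = j := by ring
  have h2 : υ + (b : ℝ) - (υ - 1 + i) = (b + 2 - 1 - i : ℕ) := by
    rw [show b + 2 - 1 - i = b + 1 - i by omega, Nat.cast_sub hi]; push_cast; ring
  rw [green, h1, h2]
  rcases lt_trichotomy i j with h | rfl | h
  · have h3 : υ - 1 + (j : ℝ) - (υ - 1 + i) - 1 = (j - 1 - i : ℕ) := by
      rw [Nat.sub_sub, Nat.cast_sub (by omega)]; push_cast; ring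
    rw [if_pos (by gcongr), if_pos h, h3]
    push_cast; rfl
  · have h3 : υ - 1 + (i : ℝ) - (υ - 1 + i) - 1 = -1 := by ring
    rw [if_pos le_rfl, if_neg (lt_irrefl i), h3, mittagLeffler_neg_one]
    push_cast; rfl
  · have h3 : (j : ℝ) < i := Nat.cast_lt.2 h
    rw [if_neg (by linarith), if_neg h.not_gt, sub_zero]
    push_cast; rfl

theorem sum_abs_green_le_greenMax (υ μ α : ℝ) {b j : ℕ} (hj : j ≤ b + 2) :
    ∑ i ∈ Finset.range (b + 2), |mittagLeffler (υ - μ) υ α j /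
        mittagLeffler (υ - μ) υ α (b + 2 : ℕ) * mittagLeffler (υ - μ) υ α (b + 2 - 1 - i : ℕ) -
        if i < j then mittagLeffler (υ - μ) υ α (j - 1 - i : ℕ) else 0| ≤ greenMax υ μ α b := by
  have hmem : υ - 1 + (j : ℝ) ∈ grid (υ - 2) (υ + (b : ℝ) + 1) :=
    (mem_grid_iff_of_eq (n := b + 3) (by push_cast; ring)).2
      ⟨j + 1, by omega, by push_cast; ring⟩
  refine le_trans (le_of_eq ?_) (Finset.le_sup' (fun t => ∑ s ∈ grid (υ - 1) (υ + (b : ℝ)),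
    |green υ μ α b t s|) hmem)
  rw [sum_grid (n := b + 1) (by push_cast; ring)]
  refine Finset.sum_congr rfl fun i hi => ?_
  rw [green_grid υ μ α b j i (Nat.lt_succ_iff.1 (Finset.mem_range.1 hi))]

theorem mittagLeffler_zero_ne_zero {θ β l : ℝ} (hθ : 0 ≤ θ) (hβ : 0 < β) (hl : |l| < 1) :
    mittagLeffler θ β l 0 ≠ 0 := by
  have h := mittagLeffler_natCast hθ hβ l 0
  rw [Nat.cast_zero] at h
  simp only [Ring.multichoose_zero_right, mul_one, tsum_geometric_of_abs_lt_one hl] at h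
  rw [h]
  have := (abs_lt.1 hl).2
  exact inv_ne_zero (by linarith)

/-- The operator of the boundary value problem is multiplication of the generating function by
`-((1 - X) ^ υ - α (1 - X) ^ μ)`. -/
theorem neg_fracDiff_add_fracDiff_eq_coeff {υ μ : ℝ} (α : ℝ) (hυ : 1 < υ ∧ υ < 2)
    (hμ : 0 < μ ∧ μ < 1) {y : ℝ → ℝ} (hy : y (υ - 2) = 0) (k : ℕ) :
    -fracDiff (υ - 2) υ y k + α * fracDiff (μ - 1) μ (fun τ => y (τ + υ - μ)) k =
      -PowerSeries.coeff (k + 1)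
        ((negBinomialSeries (-υ) - PowerSeries.C α * negBinomialSeries (-μ)) *
          PowerSeries.mk fun j : ℕ => y (υ - 1 + j)) := by
  -- The left boundary condition makes the series divisible by `X`, which aligns the order `υ` index
  -- `k + 2` with the order `μ` index `k + 1`.
  have hX : (PowerSeries.mk fun j : ℕ => y (υ - 2 + j)) =
      PowerSeries.X * PowerSeries.mk fun j : ℕ => y (υ - 1 + j) := by
    ext n
    cases n with
    | zero => simp [hy]
    | succ n =>
      rw [PowerSeries.coeff_succ_X_mul, PowerSeries.coeff_mk, PowerSeries.coeff_mk]
      congr 1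
      push_cast
      ring
  have hs : (PowerSeries.mk fun j : ℕ => y (μ - 1 + j + υ - μ)) =
      PowerSeries.mk fun j : ℕ => y (υ - 1 + j) := by
    ext n
    rw [PowerSeries.coeff_mk, PowerSeries.coeff_mk]
    congr 1
    ring
  rw [fracDiff_eq_coeff_of_lt_two hυ.1 hυ.2, fracDiff_eq_coeff_of_lt_one hμ.1 hμ.2, hX, hs,
    mul_left_comm, PowerSeries.coeff_succ_X_mul, sub_mul, map_sub, mul_assoc,
    PowerSeries.coeff_C_mul]
  ring

theorem mk_volterra (e : ℕ → ℝ) (F : ℕ → ℝ → ℝ) (c : ℝ) :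
    PowerSeries.mk (volterra e F c) = PowerSeries.C c * PowerSeries.mk e -
      PowerSeries.X * (PowerSeries.mk e * PowerSeries.mk fun i => F i (volterra e F c i)) := by
  ext n
  rw [PowerSeries.coeff_mk, volterra_eq, map_sub, PowerSeries.coeff_C_mul, PowerSeries.coeff_mk]
  congr 1
  cases n with
  | zero => simp
  | succ n =>
    rw [PowerSeries.coeff_succ_X_mul, mul_comm (PowerSeries.mk e), PowerSeries.coeff_mul,
      Finset.Nat.sum_antidiagonal_eq_sum_range_succ (fun i j =>
        PowerSeries.coeff i (PowerSeries.mk fun i => F i (volterra e F c i)) *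
          PowerSeries.coeff j (PowerSeries.mk e))]
    refine Finset.sum_congr rfl fun i _ => ?_
    rw [PowerSeries.coeff_mk, PowerSeries.coeff_mk, Nat.add_sub_cancel, mul_comm]

/-- The parameter `c` enters only the constant coefficient, which the equation never sees. -/
theorem coeff_mul_mk_volterra {P : PowerSeries ℝ} {e : ℕ → ℝ} (hP : P * PowerSeries.mk e = 1)
    (F : ℕ → ℝ → ℝ) (c : ℝ) (k : ℕ) :
    PowerSeries.coeff (k + 1) (P * PowerSeries.mk (volterra e F c)) =
      -F k (volterra e F c k) := by
  have h : P * PowerSeries.mk (volterra e F c) = PowerSeries.C c -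
      PowerSeries.X * PowerSeries.mk fun i => F i (volterra e F c i) := by
    rw [mk_volterra]
    linear_combination (PowerSeries.C c -
      PowerSeries.X * PowerSeries.mk fun i => F i (volterra e F c i)) * hP
  rw [h, map_sub, PowerSeries.coeff_succ_X_mul, PowerSeries.coeff_mk, PowerSeries.coeff_C,
    if_neg (Nat.succ_ne_zero k), zero_sub]

/-- A solution of the boundary value problem that vanishes on the grid makes `f(·, 0)` vanish. -/
theorem IsDirichletSolution.exists_ne_zero {υ μ α : ℝ} {b : ℕ} {f : ℝ → ℝ → ℝ} {y : ℝ → ℝ}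
    (hυ : 1 < υ ∧ υ < 2) (hμ : 0 < μ ∧ μ < 1) (hy : IsDirichletSolution υ μ α b f y)
    (hf : ∃ t ∈ grid 0 ((b : ℝ) + 1), f (t + υ - 1) 0 ≠ 0) :
    ∃ t ∈ grid (υ - 2) (υ + (b : ℝ) + 1), y t ≠ 0 := by
  by_contra! h
  have hzero (j : ℕ) (hj : j ≤ b + 2) : y (υ - 1 + j) = 0 :=
    h _ ((mem_grid_iff_of_eq (n := b + 3) (by push_cast; ring)).2
      ⟨j + 1, by omega, by push_cast; ring⟩)
  obtain ⟨t, ht, hft⟩ := hf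
  obtain ⟨k, hk, rfl⟩ := (mem_grid_iff_of_eq (n := b + 1) (by push_cast; ring)).1 ht
  have heq := hy.1 _ ht
  rw [zero_add, neg_fracDiff_add_fracDiff_eq_coeff α hυ hμ hy.2.1, PowerSeries.coeff_mul,
    Finset.sum_eq_zero, show (k : ℝ) + υ - 1 = υ - 1 + k by ring, hzero k (by omega)] at heq
  · apply hft
    rw [show 0 + (k : ℝ) + υ - 1 = υ - 1 + k by ring, ← heq, neg_zero]
  -- Coefficient `k + 1 ≤ b + 2` involves only values on the grid.
  · intro x hx
    have := Finset.HasAntidiagonal.mem_antidiagonal.1 hx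
    rw [PowerSeries.coeff_mk, hzero x.2 (by omega), mul_zero]

theorem mainTheorem2 (υ μ α m : ℝ) (b : ℕ) (f : ℝ → ℝ → ℝ)
    (hυ : 1 < υ ∧ υ < 2) (hμ : 0 < μ ∧ μ < 1) (hα : |α| < 1)
    (hG : mittagLeffler (υ - μ) υ α ((b : ℝ) + 2) ≠ 0)
    (hf : ContinuousOn (Function.uncurry f)
      ((grid (υ - 1) (υ + (b : ℝ)) : Set ℝ) ×ˢ (Set.univ : Set ℝ)))
    (hlim : ∀ t ∈ grid 0 ((b : ℝ) + 1),
      Tendsto (fun r : ℝ => f (t + υ - 1) r / r) (comap (fun r : ℝ => |r|) atTop) (𝓝 m))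
    (hm : |m| < 1 / greenMax υ μ α b) :
    ∃ y : ℝ → ℝ, IsDirichletSolution υ μ α b f y ∧
      ((∃ t ∈ grid 0 ((b : ℝ) + 1), f (t + υ - 1) 0 ≠ 0) →
        ∃ t ∈ grid (υ - 2) (υ + (b : ℝ) + 1), y t ≠ 0) := by
  set e : ℕ → ℝ := fun n => mittagLeffler (υ - μ) υ α n with he
  set F : ℕ → ℝ → ℝ := fun i => f (υ - 1 + i) with hF
  have hFc : ∀ i < b + 2, Continuous (F i) := by
    intro i hi
    have hmem : υ - 1 + (i : ℝ) ∈ grid (υ - 1) (υ + (b : ℝ)) :=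
      (mem_grid_iff_of_eq (n := b + 1) (by push_cast; ring)).2 ⟨i, by omega, rfl⟩
    exact hf.comp_continuous (f := fun r : ℝ => (υ - 1 + (i : ℝ), r)) (by fun_prop)
      fun r => ⟨hmem, Set.mem_univ r⟩
  have hFlim : ∀ i < b + 2,
      Tendsto (fun r => F i r / r) (comap (fun r : ℝ => |r|) atTop) (𝓝 m) := by
    intro i hi
    have h := hlim i ((mem_grid_iff_of_eq (n := b + 1) (by push_cast; ring)).2
      ⟨i, by omega, by ring⟩)
    rwa [show (i : ℝ) + υ - 1 = υ - 1 + i by ring] at h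
  -- Otherwise `1 / greenMax` would be at most `0`, also under the convention `1 / 0 = 0`.
  have hpos : 0 < greenMax υ μ α b := one_div_pos.1 ((abs_nonneg m).trans_lt hm)
  obtain ⟨c, hc⟩ := exists_volterra_eq_zero (e := e) (K := greenMax υ μ α b) hFc hFlim
    (by simpa [he] using mittagLeffler_zero_ne_zero (by linarith) (by linarith) hα)
    (by simpa [he] using hG) (fun j hj => sum_abs_green_le_greenMax υ μ α hj)
    ((lt_div_iff₀ hpos).1 hm)
  -- The point `υ - 2` is set apart because `⌊-1⌋₊ = 0` would return the value at `υ - 1`.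
  set y : ℝ → ℝ := fun t => if t = υ - 2 then 0 else volterra e F c ⌊t - (υ - 1)⌋₊ with hy
  have hy0 : y (υ - 2) = 0 := if_pos rfl
  have hyj (j : ℕ) : y (υ - 1 + j) = volterra e F c j := by
    have hj : (0 : ℝ) ≤ j := j.cast_nonneg
    simp only [hy]
    rw [if_neg (by linarith), add_sub_cancel_left, Nat.floor_natCast]
  have hsol : IsDirichletSolution υ μ α b f y := by
    refine ⟨fun t ht => ?_, hy0, ?_⟩
    · obtain ⟨k, -, rfl⟩ := (mem_grid_iff_of_eq (n := b + 1) (by push_cast; ring)).1 ht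
      rw [zero_add, neg_fracDiff_add_fracDiff_eq_coeff α hυ hμ hy0]
      simp_rw [hyj]
      rw [show (k : ℝ) + υ - 1 = υ - 1 + k by ring, hyj, coeff_mul_mk_volterra
        (sub_mul_mk_mittagLeffler (by linarith) (by linarith) hα), neg_neg]
    · rw [show υ + (b : ℝ) + 1 = υ - 1 + (b + 2 : ℕ) by push_cast; ring, hyj, hc]
  exact ⟨y, hsol, hsol.exists_ne_zero hυ hμ⟩

end
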